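/- Let $d\ge 1$ and let $L^p=L^p(\mathbb{R}^d)$ be spaces of complex-valued functions; write $\mathbb{N}=\{1,2,3,\dots\}$. For $A\in\mathrm{GL}_d(\mathbb{R})$ let $D^1_A\psi:=|\det A|\,\psi(A\,\cdot)$, $D^2_Af:=|\det A|^{1/2}f(A\,\cdot)$, and let $\sigma_{\min}(A)$ be the smallest singular value of $A$. For a set $\Phi\subseteq L^1\cap L^2$ of filters, $N\ge 0$ and $f\in L^2$ put $$W_N[\Phi](f):=\sum_{(\psi_1,\dots,\psi_N)\in\Phi^N}\big\|\,|\cdots||f*\psi_1|*\psi_2|\cdots*\psi_N|\,\big\|_2^2 ,\qquad W_0[\Phi](f):=\|f\|_2^2 .$$ A countable set $\mathfrak{G}\subseteq L^1\cap L^2$ is called a semi-discrete Parseval frame if $\sum_{\psi\in\mathfrak{G}}\|f*\psi\|_2^2=\|f\|_2^2$ for all $f\in L^2$. Let $\chi\in L^1\cap L^2$ and $\Psi\subseteq L^1\cap L^2$ be such that $\{\chi\}\cup\Psi$ is countably infinite and $$\|f*\chi\|_2^2+\sum_{\psi\in\Psi}\|f*\psi\|_2^2=\|f\|_2^2\qquad\text{for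 all } f\in L^2 .$$ **Theorem.** Let $(A_m)_{m\in\mathbb{N}}$ be a sequence in $\mathrm{GL}_d(\mathbb{R})$ with $\lim_{m\to\infty}\sigma_{\min}(A_m)=\infty$, and suppose that $\Psi_m\subseteq\Psi_{m+1}$ for all $m\in\mathbb{N}$, where $\Psi_m:=\{D^1_{A_m^{-1}}\psi:\psi\in\Psi\}$. Then $\Psi_\infty:=\bigcup_{m\in\mathbb{N}}\Psi_m$ is a semi-discrete Parseval frame, and for all $f\in L^2$ and $k\in\mathbb{N}$, $$\lim_{m\to\infty}W_k[\Psi](D^2_{A_m}f)=\|f\|_2^2 .$$ In particular, $$\inf_{f\in L^2,\ \|f\|_2=1}\ \inf_{k\in\mathbb{N}}\ \limsup_{m\to\infty}W_k[\Psi](D^2_{A_m}f)=1 ,$$ and consequently: 1. For every $g\in L^2$ there is a constant $C_g>0$ such that for every nonincreasing sequence $E=(E_N)_{N\in\mathbb{N}}$ of positive reals with $E_N\to 0$ there is $f_{g,E}\in L^2$ with (a) $\|f_{g,E}\|_2^2\le C_g(1+E_1)$, (b) $\|f_{g,E}-g\|_2^2\le C_gE_1$, and (c) $W_N[\Psi](f_{g,E})\ge\frac{\|g\|_2^2}{8}E_N$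 for all $N\in\mathbb{N}$. 2. For every such sequence $E$, the set $Y_E$ of all $f\in L^2$ for which there are $C>0$ and $N_0\in\mathbb{N}$ with $W_N[\Psi](f)\le C\,E_N$ for all $N\ge N_0$ is a countable union of nowhere dense subsets of $L^2$, and $L^2\setminus Y_E$ is dense in $L^2$. -/

import Mathlib

open MeasureTheory Filter Topology
open scoped ENNReal

namespace Scattering

/-- The Euclidean space `ℝ^d`. -/
abbrev Space (d : ℕ) : Type := EuclideanSpace ℝ (Fin d)

/-- The signal space `L²(ℝ^d)` of complex-valued functions. -/
abbrev L2 (d : ℕ) : Type := Lp ℂ 2 (volume : Measure (Space d))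

/-- The space `L¹(ℝ^d) ∩ L²(ℝ^d)` of filters, as a subgroup of the group of almost-everywhere
classes of measurable functions. -/
noncomputable def filterSubgroup (d : ℕ) : AddSubgroup (Space d →ₘ[volume] ℂ) :=
  Lp ℂ 1 volume ⊓ Lp ℂ 2 volume

/-- A filter: an element of `L¹(ℝ^d) ∩ L²(ℝ^d)`. -/
abbrev L1L2 (d : ℕ) : Type := filterSubgroup d

theorem L1L2.memLp_one {d : ℕ} (ψ : L1L2 d) :
    MemLp (ψ : Space d →ₘ[volume] ℂ) 1 volume :=
  Lp.mem_Lp_iff_memLp.1 ψ.2.1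

theorem L1L2.memLp_two {d : ℕ} (ψ : L1L2 d) :
    MemLp (ψ : Space d →ₘ[volume] ℂ) 2 volume :=
  Lp.mem_Lp_iff_memLp.1 ψ.2.2

/-! ### Dilations -/

/-- The linear map `x ↦ A x` of the Euclidean space `ℝ^d`. -/
noncomputable def act {d : ℕ} (A : GL (Fin d) ℝ) : Space d →ₗ[ℝ] Space d :=
  Matrix.toEuclideanLin (A : Matrix (Fin d) (Fin d) ℝ)

/-- The smallest singular value of `A`, for `d ≥ 1`. (In Mathlib, singular values are listed in
descending order and indexed from zero.) -/
noncomputable def sigmaMin {d : ℕ} (A : GL (Fin d) ℝ) : ℝ :=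
  (act A).singularValues (d - 1)

theorem det_act {d : ℕ} (A : GL (Fin d) ℝ) :
    LinearMap.det (act A) = (A : Matrix (Fin d) (Fin d) ℝ).det := by
  rw [act, Matrix.toEuclideanLin_eq_toLin_orthonormal, LinearMap.det_toLin]

theorem det_act_ne_zero {d : ℕ} (A : GL (Fin d) ℝ) : LinearMap.det (act A) ≠ 0 := by
  rw [det_act]
  exact ((Matrix.isUnit_iff_isUnit_det _).1 A.isUnit).ne_zero

theorem map_act_volume {d : ℕ} (A : GL (Fin d) ℝ) :
    Measure.map (act A) (volume : Measure (Space d)) =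
      ENNReal.ofReal |(LinearMap.det (act A))⁻¹| • volume :=
  Measure.map_linearMap_addHaar_eq_smul_addHaar volume (det_act_ne_zero A)

theorem measurable_act {d : ℕ} (A : GL (Fin d) ℝ) : Measurable (act A) :=
  (LinearMap.continuous_of_finiteDimensional (act A)).measurable

theorem memLp_comp_act {d : ℕ} (A : GL (Fin d) ℝ) {p : ℝ≥0∞} {f : Space d → ℂ}
    (hf : MemLp f p volume) : MemLp (fun x => f (act A x)) p volume := by
  have h : MemLp f p (Measure.map (act A) volume) := by
    rw [map_act_volume]
    exact hf.smul_measure ENNReal.ofReal_ne_top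
  exact h.comp_of_map (measurable_act A).aemeasurable

/-- The `L¹`-normalized dilation `D¹_A ψ = |det A| ψ(A ·)` of a filter. -/
noncomputable def D1 {d : ℕ} (A : GL (Fin d) ℝ) (ψ : L1L2 d) : L1L2 d :=
  have h (p : ℝ≥0∞) (hψ : MemLp (ψ : Space d →ₘ[volume] ℂ) p volume) :
      MemLp (fun x => ((|(A : Matrix (Fin d) (Fin d) ℝ).det| : ℝ) : ℂ) *
        (ψ : Space d →ₘ[volume] ℂ) (act A x)) p volume :=
    (memLp_comp_act A hψ).const_mul _
  ⟨AEEqFun.mk (fun x => ((|(A : Matrix (Fin d) (Fin d) ℝ).det| : ℝ) : ℂ) *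
      (ψ : Space d →ₘ[volume] ℂ) (act A x)) (h 1 ψ.memLp_one).1,
    ((h 1 ψ.memLp_one).toLp _).2, ((h 2 ψ.memLp_two).toLp _).2⟩

/-- The `L²`-normalized dilation `D²_A f = |det A|^(1/2) f(A ·)` of a signal. -/
noncomputable def D2 {d : ℕ} (A : GL (Fin d) ℝ) (f : L2 d) : L2 d :=
  MemLp.toLp (fun x => ((√|(A : Matrix (Fin d) (Fin d) ℝ).det| : ℝ) : ℂ) * f (act A x))
    ((memLp_comp_act A (Lp.memLp f)).const_mul _)

/-! ### Convolution and the scattering propagator -/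

/-- Young's inequality `L² * L¹ ⊆ L²`. -/
theorem memLp_convolution {d : ℕ} {f g : Space d → ℂ} (hf : MemLp f 2 volume)
    (hg : MemLp g 1 volume) :
    MemLp (convolution f g (ContinuousLinearMap.mul ℂ ℂ) volume) 2 volume := by
  have hi : AEStronglyMeasurable
      (fun q : Space d × Space d => (ContinuousLinearMap.mul ℂ ℂ) (f q.2) (g (q.1 - q.2)))
      (volume.prod volume) :=
    hf.1.convolution_integrand (ContinuousLinearMap.mul ℂ ℂ) hg.1
  have hmeas : AEStronglyMeasurable
      (convolution f g (ContinuousLinearMap.mul ℂ ℂ) volume) volume := hi.integral_prod_right'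
  have hgx (x : Space d) : AEStronglyMeasurable (fun t => g (x - t)) volume :=
    hg.1.comp_quasiMeasurePreserving
      (quasiMeasurePreserving_sub_left_of_right_invariant volume x)
  have hgt : AEStronglyMeasurable (fun q : Space d × Space d => g (q.1 - q.2))
      (volume.prod volume) :=
    hg.1.comp_quasiMeasurePreserving (quasiMeasurePreserving_sub_of_right_invariant _ _)
  set B : ℝ≥0∞ := ∫⁻ t, ‖g t‖ₑ with hB
  have hBtop : B < ⊤ := by
    have := hg.2
    rwa [eLpNorm_one_eq_lintegral_enorm] at this
  have hFtop : ∫⁻ t, ‖f t‖ₑ ^ (2 : ℝ) < ⊤ := by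
    have := lintegral_rpow_enorm_lt_top_of_eLpNorm_lt_top (p := 2) (by norm_num) (by norm_num) hf.2
    simpa using this
  have hpt (x : Space d) :
      ‖convolution f g (ContinuousLinearMap.mul ℂ ℂ) volume x‖ₑ ^ (2 : ℝ) ≤
        (∫⁻ t, ‖f t‖ₑ ^ (2 : ℝ) * ‖g (x - t)‖ₑ) * B := by
    have h1 : ‖convolution f g (ContinuousLinearMap.mul ℂ ℂ) volume x‖ₑ ≤
        ∫⁻ t, (‖f t‖ₑ * ‖g (x - t)‖ₑ ^ (1 / 2 : ℝ)) * ‖g (x - t)‖ₑ ^ (1 / 2 : ℝ) := by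
      refine (enorm_integral_le_lintegral_enorm _).trans (le_of_eq ?_)
      refine lintegral_congr fun t => ?_
      rw [mul_assoc, ← ENNReal.rpow_add_of_nonneg _ _ (by norm_num) (by norm_num)]
      norm_num
    have h2 := ENNReal.lintegral_mul_le_Lp_mul_Lq (volume : Measure (Space d))
      (p := 2) (q := 2) Real.HolderConjugate.two_two
      (f := fun t => ‖f t‖ₑ * ‖g (x - t)‖ₑ ^ (1 / 2 : ℝ))
      (g := fun t => ‖g (x - t)‖ₑ ^ (1 / 2 : ℝ))
      (hf.1.enorm.mul ((hgx x).enorm.pow_const _)) ((hgx x).enorm.pow_const _)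
    have h3 := ENNReal.rpow_le_rpow (h1.trans h2) (z := 2) (by norm_num)
    refine h3.trans (le_of_eq ?_)
    rw [ENNReal.mul_rpow_of_nonneg _ _ (by norm_num), ← ENNReal.rpow_mul, ← ENNReal.rpow_mul]
    have h4 (y : ℝ≥0∞) : (y ^ (1 / 2 : ℝ)) ^ (2 : ℝ) = y := by
      rw [← ENNReal.rpow_mul]; norm_num
    have h5 : ∫⁻ t, ‖g (x - t)‖ₑ = B := lintegral_sub_left_eq_self (fun t => ‖g t‖ₑ) x
    simp only [ENNReal.mul_rpow_of_nonneg _ _ (show (0 : ℝ) ≤ 2 by norm_num), h4, h5]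
    norm_num
  refine ⟨hmeas, ?_⟩
  rw [eLpNorm_lt_top_iff_lintegral_rpow_enorm_lt_top (by norm_num) (by norm_num)]
  simp only [ENNReal.toReal_ofNat]
  calc ∫⁻ x, ‖convolution f g (ContinuousLinearMap.mul ℂ ℂ) volume x‖ₑ ^ (2 : ℝ)
      ≤ ∫⁻ x, (∫⁻ t, ‖f t‖ₑ ^ (2 : ℝ) * ‖g (x - t)‖ₑ) * B := lintegral_mono hpt
    _ = (∫⁻ x, ∫⁻ t, ‖f t‖ₑ ^ (2 : ℝ) * ‖g (x - t)‖ₑ) * B := lintegral_mul_const' _ _ hBtop.ne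
    _ = (∫⁻ t, ∫⁻ x, ‖f t‖ₑ ^ (2 : ℝ) * ‖g (x - t)‖ₑ) * B := by
        rw [lintegral_lintegral_swap]
        exact (hf.1.comp_snd.enorm.pow_const _).mul hgt.enorm
    _ = (∫⁻ t, ‖f t‖ₑ ^ (2 : ℝ) * B) * B := by
        congr 1
        refine lintegral_congr fun t => ?_
        rw [lintegral_const_mul' _ _ (by simp)]
        congr 1
        exact lintegral_sub_right_eq_self (fun t => ‖g t‖ₑ) t
    _ < ⊤ := by
        rw [lintegral_mul_const' _ _ hBtop.ne]
        exact ENNReal.mul_lt_top (ENNReal.mul_lt_top hFtop hBtop) hBtop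

/-- The convolution `f * ψ ∈ L²(ℝ^d)` of a signal and a filter,
`(f * ψ)(x) = ∫ f(t) ψ(x - t) dt`. -/
noncomputable def conv {d : ℕ} (f : L2 d) (ψ : L1L2 d) : L2 d :=
  MemLp.toLp (convolution f (ψ : Space d →ₘ[volume] ℂ) (ContinuousLinearMap.mul ℂ ℂ) volume)
    (memLp_convolution (Lp.memLp f) ψ.memLp_one)

/-- The modulus `|f|`, as a complex-valued function in `L²(ℝ^d)`. -/
noncomputable def modulus {d : ℕ} (f : L2 d) : L2 d :=
  MemLp.toLp (fun x => ((‖f x‖ : ℝ) : ℂ)) (Lp.memLp f).norm.ofReal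

/-- The scattering propagator along a path `p = (ψ₁, …, ψ_N)`,
`U[p] f = | … | |f * ψ₁| * ψ₂ | … * ψ_N |`; it is the identity for the empty path. -/
noncomputable def U {d : ℕ} : (N : ℕ) → (Fin N → L1L2 d) → L2 d → L2 d
  | 0, _, f => f
  | N + 1, p, f => U N (Fin.tail p) (modulus (conv f (p 0)))

/-- The energy `W_N[Φ](f) = ∑_{p ∈ Φ^N} ‖U[p] f‖²`, as a sum in `[0, ∞]`. -/
noncomputable def W {d : ℕ} (Φ : Set (L1L2 d)) (N : ℕ) (f : L2 d) : ℝ≥0∞ :=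
  ∑' p : Fin N → Φ, ‖U N (fun i => (p i : L1L2 d)) f‖ₑ ^ 2

/-! ### Filter banks -/

/-- A countable set `𝔉` of filters is a semi-discrete Parseval frame if
`∑_{ψ ∈ 𝔉} ‖f * ψ‖² = ‖f‖²` for all `f ∈ L²(ℝ^d)`. -/
def IsSemiDiscreteParsevalFrame {d : ℕ} (F : Set (L1L2 d)) : Prop :=
  F.Countable ∧ ∀ f : L2 d, ∑' ψ : F, ‖conv f ψ‖ₑ ^ 2 = ‖f‖ₑ ^ 2

/-- The output-generating filter `χ` and the filters `Ψ` form a countably infinite collection with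
`‖f * χ‖² + ∑_{ψ ∈ Ψ} ‖f * ψ‖² = ‖f‖²` for all `f ∈ L²(ℝ^d)`. -/
structure IsFilterBank {d : ℕ} (χ : L1L2 d) (Ψ : Set (L1L2 d)) : Prop where
  countable : (insert χ Ψ).Countable
  infinite : (insert χ Ψ).Infinite
  parseval : ∀ f : L2 d, ‖conv f χ‖ₑ ^ 2 + ∑' ψ : Ψ, ‖conv f ψ‖ₑ ^ 2 = ‖f‖ₑ ^ 2

/-! ### Slow decay -/

/-- `δ = inf_{‖f‖ = 1} inf_{k ∈ ℕ} limsup_{m → ∞} W_k[Ψ](D²_{A_m} f)`, with `ℕ = {1, 2, …}`. -/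
noncomputable def slowDelta {d : ℕ} (Ψ : Set (L1L2 d)) (A : ℕ+ → GL (Fin d) ℝ) : ℝ≥0∞ :=
  ⨅ f : {f : L2 d // ‖f‖ = 1}, ⨅ k : ℕ+, limsup (fun m : ℕ+ => W Ψ k (D2 (A m) f)) atTop

/-- `(E_N)_{N ≥ 1}` is a nonincreasing null-sequence of positive numbers. -/
structure IsNullSeq (E : ℕ+ → ℝ) : Prop where
  pos : ∀ N, 0 < E N
  antitone : Antitone E
  tendsto : Tendsto E atTop (𝓝 0)

/-- The set `Y_E` of all signals `f` with `W_N[Ψ](f) ∈ O(E_N)`. -/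
def fastSet {d : ℕ} (Ψ : Set (L1L2 d)) (E : ℕ+ → ℝ) : Set (L2 d) :=
  {f | ∃ C > (0 : ℝ), ∃ N₀ : ℕ+, ∀ N ≥ N₀, W Ψ N f ≤ ENNReal.ofReal (C * E N)}

end Scattering

open Scattering

namespace Scattering

variable {d : ℕ}

/-! ### Convolution -/

/-! Dilations intertwine with convolution and modulus (`conv_D2`, `modulus_D2`), so dilating the
signal amounts to dilating the filters: `W_D2`. As `Ψ_m` increases, the energies increase to that of
`Ψ_∞` (`W_iUnion`). Since `|det A_m| → ∞`, the `L²` norms of the dilated filters `χ` tend to zero,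
so in the limit `χ` carries no energy and `Ψ_∞` is a Parseval frame. Such a frame loses nothing at
any layer (`W_eq_enorm_sq`), which gives the limit `‖f‖²`.

Slow decay is a gliding hump argument. Strongly dilated copies of `g`, with geometrically decreasing
coefficients, are added to `g`; each copy keeps the energy large on the finitely many layers of its
scale. What was built before does no harm (`eventually_lt_sqrt_W_add_D2`): after undoing the
dilation, it is uniformly small up to an `L²` error. What is added later does no harm because `√W`
is `1`-Lipschitz (`sqrt_W_le`).

The set `Y_E` is a countable union of closed sets, and slowly decaying signals near every signal
make its complement dense. -/

theorem coeFn_conv (f : L2 d) (ψ : L1L2 d) :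
    conv f ψ =ᵐ[volume]
      convolution f (ψ : Space d →ₘ[volume] ℂ) (ContinuousLinearMap.mul ℂ ℂ) volume :=
  MemLp.coeFn_toLp _

theorem coeFn_modulus (f : L2 d) : modulus f =ᵐ[volume] fun x => ((‖f x‖ : ℝ) : ℂ) :=
  MemLp.coeFn_toLp _

theorem integrable_mul_sub {f g : Space d → ℂ} (hf : MemLp f 2 volume) (hg : MemLp g 2 volume)
    (x : Space d) : Integrable (fun t => f t * g (x - t)) volume :=
  hf.integrable_mul (hg.comp_measurePreserving (Measure.measurePreserving_sub_left volume x))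

theorem conv_sub (f g : L2 d) (ψ : L1L2 d) : conv (f - g) ψ = conv f ψ - conv g ψ := by
  refine Lp.ext ?_
  filter_upwards [coeFn_conv (f - g) ψ, coeFn_conv f ψ, coeFn_conv g ψ,
    Lp.coeFn_sub (conv f ψ) (conv g ψ)] with x h1 h2 h3 h4
  rw [h1, h4, Pi.sub_apply, h2, h3]
  simp only [convolution_def, ContinuousLinearMap.mul_apply']
  rw [← integral_sub (integrable_mul_sub (Lp.memLp f) ψ.memLp_two x)
    (integrable_mul_sub (Lp.memLp g) ψ.memLp_two x)]
  refine integral_congr_ae ?_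
  filter_upwards [Lp.coeFn_sub f g] with t ht
  rw [ht, Pi.sub_apply, sub_mul]

/-- `‖f * ψ‖_∞ ≤ ‖f‖_∞ ‖ψ‖₁`. -/
theorem ae_norm_conv_le {f : L2 d} {c : ℝ} (hf : ∀ᵐ x, ‖f x‖ ≤ c) (ψ : L1L2 d) :
    ∀ᵐ x, ‖conv f ψ x‖ ≤ c * ∫ t, ‖(ψ : Space d →ₘ[volume] ℂ) t‖ := by
  filter_upwards [coeFn_conv f ψ] with x hx
  rw [hx, convolution_def]
  have hψ : Integrable (fun t => (ψ : Space d →ₘ[volume] ℂ) (x - t)) volume :=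
    (memLp_one_iff_integrable.1 ψ.memLp_one).comp_sub_left x
  calc _ ≤ ∫ t, c * ‖(ψ : Space d →ₘ[volume] ℂ) (x - t)‖ := by
        refine norm_integral_le_of_norm_le (hψ.norm.const_mul c) ?_
        filter_upwards [hf] with t ht
        rw [ContinuousLinearMap.mul_apply', norm_mul]
        gcongr
    _ = _ := by
        rw [integral_const_mul,
          integral_sub_left_eq_self (fun t => ‖(ψ : Space d →ₘ[volume] ℂ) t‖) volume x]

/-- Young's inequality `‖f * g‖₂ ≤ ‖f‖₂ ‖g‖₁`. -/
theorem eLpNorm_convolution_le {f g : Space d → ℂ} (hf : MemLp f 2 volume)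
    (hg : MemLp g 1 volume) :
    eLpNorm (convolution f g (ContinuousLinearMap.mul ℂ ℂ) volume) 2 volume ≤
      eLpNorm f 2 volume * eLpNorm g 1 volume := by
  have hgx (x : Space d) : AEStronglyMeasurable (fun t => g (x - t)) volume :=
    hg.1.comp_quasiMeasurePreserving
      (quasiMeasurePreserving_sub_left_of_right_invariant volume x)
  have hgt : AEStronglyMeasurable (fun q : Space d × Space d => g (q.1 - q.2))
      (volume.prod volume) :=
    hg.1.comp_quasiMeasurePreserving (quasiMeasurePreserving_sub_of_right_invariant _ _)
  set B : ℝ≥0∞ := eLpNorm g 1 volume with hB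
  have hBtop : B ≠ ⊤ := hg.2.ne
  have hB' : B = ∫⁻ t, ‖g t‖ₑ := eLpNorm_one_eq_lintegral_enorm
  have hpt (x : Space d) :
      ‖convolution f g (ContinuousLinearMap.mul ℂ ℂ) volume x‖ₑ ^ (2 : ℝ) ≤
        (∫⁻ t, ‖f t‖ₑ ^ (2 : ℝ) * ‖g (x - t)‖ₑ) * B := by
    have h1 : ‖convolution f g (ContinuousLinearMap.mul ℂ ℂ) volume x‖ₑ ≤
        ∫⁻ t, (‖f t‖ₑ * ‖g (x - t)‖ₑ ^ (1 / 2 : ℝ)) * ‖g (x - t)‖ₑ ^ (1 / 2 : ℝ) := by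
      refine (enorm_integral_le_lintegral_enorm _).trans (le_of_eq ?_)
      refine lintegral_congr fun t => ?_
      rw [mul_assoc, ← ENNReal.rpow_add_of_nonneg _ _ (by norm_num) (by norm_num)]
      norm_num
    have h2 := ENNReal.lintegral_mul_le_Lp_mul_Lq (volume : Measure (Space d))
      (p := 2) (q := 2) Real.HolderConjugate.two_two
      (f := fun t => ‖f t‖ₑ * ‖g (x - t)‖ₑ ^ (1 / 2 : ℝ))
      (g := fun t => ‖g (x - t)‖ₑ ^ (1 / 2 : ℝ))
      (hf.1.enorm.mul ((hgx x).enorm.pow_const _)) ((hgx x).enorm.pow_const _)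
    have h3 := ENNReal.rpow_le_rpow (h1.trans h2) (z := 2) (by norm_num)
    refine h3.trans (le_of_eq ?_)
    rw [ENNReal.mul_rpow_of_nonneg _ _ (by norm_num), ← ENNReal.rpow_mul, ← ENNReal.rpow_mul]
    have h4 (y : ℝ≥0∞) : (y ^ (1 / 2 : ℝ)) ^ (2 : ℝ) = y := by
      rw [← ENNReal.rpow_mul]; norm_num
    have h5 : ∫⁻ t, ‖g (x - t)‖ₑ = B :=
      (lintegral_sub_left_eq_self (fun t => ‖g t‖ₑ) x).trans hB'.symm
    simp only [ENNReal.mul_rpow_of_nonneg _ _ (show (0 : ℝ) ≤ 2 by norm_num), h4, h5]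
    norm_num
  have key : ∫⁻ x, ‖convolution f g (ContinuousLinearMap.mul ℂ ℂ) volume x‖ₑ ^ (2 : ℝ) ≤
      (∫⁻ t, ‖f t‖ₑ ^ (2 : ℝ)) * B ^ (2 : ℝ) :=
    calc ∫⁻ x, ‖convolution f g (ContinuousLinearMap.mul ℂ ℂ) volume x‖ₑ ^ (2 : ℝ)
      ≤ ∫⁻ x, (∫⁻ t, ‖f t‖ₑ ^ (2 : ℝ) * ‖g (x - t)‖ₑ) * B := lintegral_mono hpt
    _ = (∫⁻ x, ∫⁻ t, ‖f t‖ₑ ^ (2 : ℝ) * ‖g (x - t)‖ₑ) * B := lintegral_mul_const' _ _ hBtop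
    _ = (∫⁻ t, ∫⁻ x, ‖f t‖ₑ ^ (2 : ℝ) * ‖g (x - t)‖ₑ) * B := by
        rw [lintegral_lintegral_swap]
        exact (hf.1.comp_snd.enorm.pow_const _).mul hgt.enorm
    _ = (∫⁻ t, ‖f t‖ₑ ^ (2 : ℝ) * B) * B := by
        congr 1
        refine lintegral_congr fun t => ?_
        rw [lintegral_const_mul' _ _ (by simp), hB']
        congr 1
        exact lintegral_sub_right_eq_self (fun t => ‖g t‖ₑ) t
    _ = _ := by
        rw [lintegral_mul_const' _ _ hBtop, mul_assoc, ENNReal.rpow_two, sq]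
  rw [eLpNorm_eq_lintegral_rpow_enorm_toReal (by norm_num) (by norm_num),
    eLpNorm_eq_lintegral_rpow_enorm_toReal (by norm_num) (by norm_num)]
  simp only [ENNReal.toReal_ofNat]
  refine (ENNReal.rpow_le_rpow key (by norm_num)).trans (le_of_eq ?_)
  rw [ENNReal.mul_rpow_of_nonneg _ _ (by norm_num), ← ENNReal.rpow_mul]
  norm_num

/-- Young's inequality `‖f * ψ‖₂ ≤ ‖f‖₁ ‖ψ‖₂`. -/
theorem enorm_conv_le (f : L2 d) (hf : MemLp f 1 volume) (ψ : L1L2 d) :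
    ‖conv f ψ‖ₑ ≤ eLpNorm f 1 volume * eLpNorm (ψ : Space d →ₘ[volume] ℂ) 2 volume := by
  -- Convolution commutes, so the signal can take the `L¹` role and the filter the `L²` role.
  rw [conv, Lp.enorm_toLp, ← convolution_flip, ContinuousLinearMap.flip_mul, mul_comm]
  exact eLpNorm_convolution_le ψ.memLp_two hf

theorem enorm_modulus (f : L2 d) : ‖modulus f‖ₑ = ‖f‖ₑ := by
  rw [modulus, Lp.enorm_toLp, Lp.enorm_def]
  exact eLpNorm_congr_norm_ae (.of_forall fun x => by simp)

theorem ae_norm_modulus_sub_le (f g : L2 d) :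
    ∀ᵐ x, ‖modulus f x - modulus g x‖ ≤ ‖f x - g x‖ := by
  filter_upwards [coeFn_modulus f, coeFn_modulus g] with x h1 h2
  rw [h1, h2, ← Complex.ofReal_sub, Complex.norm_real]
  exact abs_norm_sub_norm_le _ _

theorem enorm_modulus_sub_le (f g : L2 d) : ‖modulus f - modulus g‖ₑ ≤ ‖f - g‖ₑ := by
  rw [Lp.enorm_def, Lp.enorm_def]
  refine eLpNorm_mono_ae ?_
  filter_upwards [ae_norm_modulus_sub_le f g, Lp.coeFn_sub f g,
    Lp.coeFn_sub (modulus f) (modulus g)] with x h1 h2 h3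
  rwa [h2, h3]

/-- A uniform bound on `f - g` propagates along a path. -/
theorem exists_ae_norm_U_sub_le (N : ℕ) (p : Fin N → L1L2 d) :
    ∃ K : ℝ, ∀ (f g : L2 d) (c : ℝ), (∀ᵐ x, ‖f x - g x‖ ≤ c) →
      ∀ᵐ x, ‖U N p f x - U N p g x‖ ≤ c * K := by
  induction N with
  | zero => exact ⟨1, fun f g c h => by simpa [U] using h⟩
  | succ N ih =>
    obtain ⟨K, hK⟩ := ih (Fin.tail p)
    refine ⟨(∫ t, ‖(p 0 : Space d →ₘ[volume] ℂ) t‖) * K, fun f g c h => ?_⟩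
    rw [← mul_assoc]
    refine hK (modulus (conv f (p 0))) (modulus (conv g (p 0))) _ ?_
    have h1 : ∀ᵐ x, ‖(f - g : L2 d) x‖ ≤ c := by
      filter_upwards [h, Lp.coeFn_sub f g] with x h h'
      rwa [h']
    filter_upwards [ae_norm_conv_le h1 (p 0), ae_norm_modulus_sub_le (conv f (p 0)) (conv g (p 0)),
      Lp.coeFn_sub (conv f (p 0)) (conv g (p 0))] with x h2 h3 h4
    rw [conv_sub, h4] at h2
    exact h3.trans h2

/-! ### The energy `W` -/

/-- `∑_{ψ ∈ Φ} ‖f * ψ‖² ≤ ‖f‖²` for all `f ∈ L²(ℝ^d)`. -/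
def IsBesselFamily (Φ : Set (L1L2 d)) : Prop :=
  ∀ f : L2 d, ∑' ψ : Φ, ‖conv f ψ‖ₑ ^ 2 ≤ ‖f‖ₑ ^ 2

theorem tsum_fin_succ {α : Type*} (N : ℕ) (F : (Fin (N + 1) → α) → ℝ≥0∞) :
    ∑' p, F p = ∑' a, ∑' p : Fin N → α, F (Fin.cons a p) := by
  rw [← (Fin.consEquiv fun _ : Fin (N + 1) => α).tsum_eq, ENNReal.tsum_prod']
  rfl

theorem U_cons {Φ : Set (L1L2 d)} (N : ℕ) (ψ : Φ) (p : Fin N → Φ) (f : L2 d) :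
    U (N + 1) (fun i => ((Fin.cons ψ p : Fin (N + 1) → Φ) i : L1L2 d)) f =
      U N (fun i => (p i : L1L2 d)) (modulus (conv f ψ)) := rfl

theorem W_zero (Φ : Set (L1L2 d)) (f : L2 d) : W Φ 0 f = ‖f‖ₑ ^ 2 := by
  simp [W, U]

theorem W_succ (Φ : Set (L1L2 d)) (N : ℕ) (f : L2 d) :
    W Φ (N + 1) f = ∑' ψ : Φ, W Φ N (modulus (conv f ψ)) := by
  simp only [W, tsum_fin_succ, U_cons]

/-- Induction over layers: the Bessel bound controls the convolutions of the difference, and the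
modulus is a contraction. -/
theorem tsum_enorm_U_sub_le {Φ : Set (L1L2 d)} (hΦ : IsBesselFamily Φ) (N : ℕ) (f g : L2 d) :
    ∑' p : Fin N → Φ,
      ‖U N (fun i => (p i : L1L2 d)) f - U N (fun i => (p i : L1L2 d)) g‖ₑ ^ 2 ≤
        ‖f - g‖ₑ ^ 2 := by
  induction N generalizing f g with
  | zero => simp [U]
  | succ N ih =>
    rw [tsum_fin_succ]
    simp only [U_cons]
    refine le_trans (ENNReal.tsum_le_tsum fun ψ => (ih _ _).trans
      (pow_le_pow_left' (enorm_modulus_sub_le _ _) 2)) ?_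
    simpa only [conv_sub] using hΦ (f - g)

theorem W_eq_enorm_sq {Φ : Set (L1L2 d)} (hΦ : IsSemiDiscreteParsevalFrame Φ) (N : ℕ)
    (f : L2 d) : W Φ N f = ‖f‖ₑ ^ 2 := by
  induction N generalizing f with
  | zero => exact W_zero Φ f
  | succ N ih => simp only [W_succ, ih, enorm_modulus, hΦ.2]

/-- Minkowski's inequality in `ℓ²`. -/
theorem tsum_add_sq_rpow_le {ι : Type*} (a b : ι → ℝ≥0∞) :
    (∑' i, (a i + b i) ^ 2) ^ (1 / 2 : ℝ) ≤
      (∑' i, a i ^ 2) ^ (1 / 2 : ℝ) + (∑' i, b i ^ 2) ^ (1 / 2 : ℝ) := by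
  -- With counting measure on the discrete σ-algebra, the integral inequality becomes one for sums.
  let _ : MeasurableSpace ι := ⊤
  have h := ENNReal.lintegral_Lp_add_le (μ := Measure.count) (p := 2) (f := a) (g := b)
    (measurable_from_top.aemeasurable) (measurable_from_top.aemeasurable) (by norm_num)
  simpa [lintegral_count] using h

/-- The square root of `W` is `1`-Lipschitz. -/
theorem sqrt_W_le {Φ : Set (L1L2 d)} (hΦ : IsBesselFamily Φ) (N : ℕ) (f g : L2 d) :
    W Φ N f ^ (1 / 2 : ℝ) ≤ W Φ N g ^ (1 / 2 : ℝ) + ‖f - g‖ₑ := by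
  have h1 : W Φ N f ≤ ∑' p : Fin N → Φ, (‖U N (fun i => (p i : L1L2 d)) g‖ₑ +
      ‖U N (fun i => (p i : L1L2 d)) f - U N (fun i => (p i : L1L2 d)) g‖ₑ) ^ 2 := by
    refine ENNReal.tsum_le_tsum fun p => pow_le_pow_left' ?_ 2
    refine le_trans (le_of_eq ?_) (enorm_add_le _ _)
    congr 1
    abel
  refine (ENNReal.rpow_le_rpow h1 (by norm_num)).trans ((tsum_add_sq_rpow_le _ _).trans ?_)
  refine add_le_add le_rfl ?_
  refine (ENNReal.rpow_le_rpow (tsum_enorm_U_sub_le hΦ N f g) (by norm_num)).trans (le_of_eq ?_)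
  rw [← ENNReal.rpow_two, ← ENNReal.rpow_mul]
  norm_num

theorem W_mono {Φ Φ' : Set (L1L2 d)} (h : Φ ⊆ Φ') (N : ℕ) (f : L2 d) : W Φ N f ≤ W Φ' N f := by
  refine ENNReal.tsum_comp_le_tsum_of_injective (f := fun (p : Fin N → Φ) i => Set.inclusion h (p i))
    ?_ (fun p : Fin N → Φ' => ‖U N (fun i => (p i : L1L2 d)) f‖ₑ ^ 2)
  intro p q hpq
  funext i
  exact Set.inclusion_injective h (congrFun hpq i)

/-- The energy of an increasing union is the supremum of the energies. -/
theorem W_iUnion {ι : Type*} [Nonempty ι] [SemilatticeSup ι] {Φ : ι → Set (L1L2 d)}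
    (hΦ : Monotone Φ) (N : ℕ) (f : L2 d) :
    W (⋃ m, Φ m) N f = ⨆ m, W (Φ m) N f := by
  classical
  refine le_antisymm ?_ (iSup_le fun m => W_mono (Set.subset_iUnion Φ m) N f)
  rw [W, ENNReal.tsum_eq_iSup_sum]
  refine iSup_le fun s => ?_
  -- A path has finitely many filters, so directedness places all of them in a single `Φ m`.
  have hex (p : Fin N → ↥(⋃ m, Φ m)) : ∃ m, ∀ i, (p i : L1L2 d) ∈ Φ m := by
    choose m hm using fun i => Set.mem_iUnion.1 (p i).2
    obtain ⟨M, hM⟩ := Finset.exists_le (Finset.univ.image m)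
    exact ⟨M, fun i => hΦ (hM _ (Finset.mem_image_of_mem _ (Finset.mem_univ i))) (hm i)⟩
  choose m hm using hex
  obtain ⟨M, hM⟩ := Finset.exists_le (s.image m)
  refine le_trans ?_ (le_iSup _ M)
  have hmem : ∀ p ∈ s, ∀ i, (p i : L1L2 d) ∈ Φ M := fun p hp i =>
    hΦ (hM _ (Finset.mem_image_of_mem _ hp)) (hm p i)
  rw [← Finset.sum_coe_sort s]
  refine le_trans (le_of_eq ?_) (ENNReal.tsum_comp_le_tsum_of_injective
    (f := fun (p : s) i => (⟨(p : Fin N → ↥(⋃ m, Φ m)) i, hmem p p.2 i⟩ : Φ M)) ?_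
    (fun p : Fin N → Φ M => ‖U N (fun i => (p i : L1L2 d)) f‖ₑ ^ 2))
  · rw [tsum_fintype]
  · intro p q hpq
    refine Subtype.ext (funext fun i => Subtype.ext ?_)
    have h := congrFun hpq i
    simpa using h

theorem tsum_enorm_conv_eq_W (Φ : Set (L1L2 d)) (f : L2 d) :
    ∑' ψ : Φ, ‖conv f ψ‖ₑ ^ 2 = W Φ 1 f := by
  simp only [W_succ, W_zero, enorm_modulus]

/-! ### Dilations -/

/-- The determinant of a dilation matrix, in absolute value. -/
noncomputable def absDet (A : GL (Fin d) ℝ) : ℝ := |(A : Matrix (Fin d) (Fin d) ℝ).det|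

theorem absDet_pos (A : GL (Fin d) ℝ) : 0 < absDet A := by
  have h := det_act_ne_zero A
  rw [det_act] at h
  exact abs_pos.2 h

theorem absDet_inv (A : GL (Fin d) ℝ) : absDet A⁻¹ = (absDet A)⁻¹ := by
  rw [absDet, absDet, Matrix.coe_units_inv, Matrix.det_nonsing_inv, Ring.inverse_eq_inv', abs_inv]

/-- `|det A|` is the product of the `d` singular values. The hypothesis on `sigmaMin` enters the
argument only through this bound. -/
theorem sigmaMin_pow_le_absDet (A : GL (Fin d) ℝ) : sigmaMin A ^ d ≤ absDet A := by
  rw [absDet, ← det_act, ← LinearMap.normDet_eq_abs_det, LinearMap.normDet_eq_prod_singularValues,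
    finrank_euclideanSpace_fin]
  refine le_trans (le_of_eq ?_) (Finset.prod_le_prod (f := fun _ => sigmaMin A)
    (fun i _ => LinearMap.singularValues_nonneg _ _) fun i hi => ?_)
  · simp
  · have := Finset.mem_range.1 hi
    exact LinearMap.singularValues_antitone _ (by omega)

theorem act_inv_act (A : GL (Fin d) ℝ) (x : Space d) : act A⁻¹ (act A x) = x := by
  rw [act, act, ← LinearMap.comp_apply]
  ext i
  simp [Matrix.toLpLin_apply, Matrix.mulVec_mulVec]

theorem act_act_inv (A : GL (Fin d) ℝ) (x : Space d) : act A (act A⁻¹ x) = x := by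
  simpa using act_inv_act A⁻¹ x

theorem quasiMeasurePreserving_act (A : GL (Fin d) ℝ) :
    Measure.QuasiMeasurePreserving (act A) volume volume :=
  ⟨measurable_act A, by
    rw [map_act_volume]
    exact Measure.smul_absolutelyContinuous⟩

theorem measurableEmbedding_act (A : GL (Fin d) ℝ) : MeasurableEmbedding (act A) :=
  (MeasurableEquiv.mk ⟨act A, act A⁻¹, act_inv_act A, act_act_inv A⟩
    (measurable_act A) (measurable_act A⁻¹)).measurableEmbedding

theorem integral_comp_act (A : GL (Fin d) ℝ) {E : Type*} [NormedAddCommGroup E] [NormedSpace ℝ E]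
    (f : Space d → E) : ∫ x, f (act A x) = (absDet A)⁻¹ • ∫ x, f x := by
  rw [← (measurableEmbedding_act A).integral_map, map_act_volume, integral_smul_measure, det_act,
    abs_inv, ENNReal.toReal_ofReal (by positivity), absDet]

theorem eLpNorm_comp_act (A : GL (Fin d) ℝ) {f : Space d → ℂ} (hf : AEStronglyMeasurable f volume) :
    eLpNorm (fun x => f (act A x)) 2 volume =
      ENNReal.ofReal (√(absDet A))⁻¹ * eLpNorm f 2 volume := by
  have h := eLpNorm_map_measure (p := 2) (μ := volume) (f := act A) (g := f)
    (by rw [map_act_volume]; exact hf.smul_measure _) (measurable_act A).aemeasurable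
  rw [Function.comp_def] at h
  rw [← h, map_act_volume, eLpNorm_smul_measure_of_ne_top (by norm_num), det_act, abs_inv,
    ← absDet]
  rw [smul_eq_mul, ENNReal.ofReal_rpow_of_pos (inv_pos.2 (absDet_pos A))]
  congr 2
  rw [Real.sqrt_eq_rpow, ← Real.inv_rpow (absDet_pos A).le]
  norm_num

theorem coeFn_D2 (A : GL (Fin d) ℝ) (f : L2 d) :
    D2 A f =ᵐ[volume] fun x => ((√(absDet A) : ℝ) : ℂ) * f (act A x) :=
  MemLp.coeFn_toLp _

theorem coeFn_D1 (A : GL (Fin d) ℝ) (ψ : L1L2 d) :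
    (D1 A ψ : Space d →ₘ[volume] ℂ) =ᵐ[volume]
      fun x => ((absDet A : ℝ) : ℂ) * (ψ : Space d →ₘ[volume] ℂ) (act A x) :=
  AEEqFun.coeFn_mk _ _

theorem D2_add (A : GL (Fin d) ℝ) (f g : L2 d) : D2 A (f + g) = D2 A f + D2 A g := by
  refine Lp.ext ?_
  filter_upwards [coeFn_D2 A (f + g), coeFn_D2 A f, coeFn_D2 A g, Lp.coeFn_add (D2 A f) (D2 A g),
    (quasiMeasurePreserving_act A).ae (Lp.coeFn_add f g)] with x h1 h2 h3 h4 h5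
  rw [h1, h4, Pi.add_apply, h2, h3, h5, Pi.add_apply, mul_add]

theorem enorm_D2 (A : GL (Fin d) ℝ) (f : L2 d) : ‖D2 A f‖ₑ = ‖f‖ₑ := by
  have h := absDet_pos A
  rw [D2, Lp.enorm_toLp, Lp.enorm_def]
  change eLpNorm (((√(absDet A) : ℝ) : ℂ) • fun x => f (act A x)) 2 volume = _
  rw [eLpNorm_const_smul, eLpNorm_comp_act A (Lp.aestronglyMeasurable f), ← mul_assoc,
    ← ofReal_norm, Complex.norm_real, Real.norm_of_nonneg (by positivity),
    ← ENNReal.ofReal_mul (by positivity), mul_inv_cancel₀ (by positivity)]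
  simp

theorem D2_D2_inv (A : GL (Fin d) ℝ) (f : L2 d) : D2 A (D2 A⁻¹ f) = f := by
  have h := absDet_pos A
  refine Lp.ext ?_
  filter_upwards [coeFn_D2 A (D2 A⁻¹ f),
    (quasiMeasurePreserving_act A).ae (coeFn_D2 A⁻¹ f)] with x h1 h2
  rw [h1, h2, act_inv_act, ← mul_assoc, ← Complex.ofReal_mul, absDet_inv, Real.sqrt_inv,
    mul_inv_cancel₀ (by positivity)]
  simp

theorem D1_D1_inv (A : GL (Fin d) ℝ) (ψ : L1L2 d) : D1 A (D1 A⁻¹ ψ) = ψ := by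
  have h := absDet_pos A
  refine Subtype.ext (AEEqFun.ext ?_)
  filter_upwards [coeFn_D1 A (D1 A⁻¹ ψ),
    (quasiMeasurePreserving_act A).ae (coeFn_D1 A⁻¹ ψ)] with x h1 h2
  rw [h1, h2, act_inv_act, ← mul_assoc, ← Complex.ofReal_mul, absDet_inv,
    mul_inv_cancel₀ h.ne']
  simp

/-- Ensures that passing to the set of dilated filters merges no terms of the energy sum. -/
theorem D1_injective (A : GL (Fin d) ℝ) : Function.Injective (D1 A) := by
  have h := D1_D1_inv A⁻¹
  rw [inv_inv] at h
  exact Function.LeftInverse.injective h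

theorem modulus_D2 (A : GL (Fin d) ℝ) (f : L2 d) : modulus (D2 A f) = D2 A (modulus f) := by
  refine Lp.ext ?_
  filter_upwards [coeFn_modulus (D2 A f), coeFn_D2 A f, coeFn_D2 A (modulus f),
    (quasiMeasurePreserving_act A).ae (coeFn_modulus f)] with x h1 h2 h3 h4
  rw [h1, h2, h3, h4, norm_mul, Complex.norm_real, Real.norm_of_nonneg (Real.sqrt_nonneg _),
    Complex.ofReal_mul]

/-- `(D²_A f) * ψ = D²_A (f * D¹_{A⁻¹} ψ)`. -/
theorem conv_D2 (A : GL (Fin d) ℝ) (f : L2 d) (ψ : L1L2 d) :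
    conv (D2 A f) ψ = D2 A (conv f (D1 A⁻¹ ψ)) := by
  refine Lp.ext ?_
  filter_upwards [coeFn_conv (D2 A f) ψ, coeFn_D2 A (conv f (D1 A⁻¹ ψ)),
    (quasiMeasurePreserving_act A).ae (coeFn_conv f (D1 A⁻¹ ψ))] with x h1 h2 h3
  rw [h1, h2, h3]
  simp only [convolution_def, ContinuousLinearMap.mul_apply']
  have e1 : ∫ t, f t * (D1 A⁻¹ ψ : Space d →ₘ[volume] ℂ) (act A x - t) =
      ∫ t, f t * (((absDet A)⁻¹ : ℝ) * (ψ : Space d →ₘ[volume] ℂ) (x - act A⁻¹ t)) := by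
    refine integral_congr_ae ?_
    filter_upwards [(quasiMeasurePreserving_sub_left_of_right_invariant volume (act A x)).ae
      (coeFn_D1 A⁻¹ ψ)] with t ht
    rw [ht, map_sub, act_inv_act, absDet_inv]
  have e2 : ∫ t, D2 A f t * (ψ : Space d →ₘ[volume] ℂ) (x - t) =
      ∫ t, (fun s => (((√(absDet A) : ℝ) : ℂ) * f s) *
        (ψ : Space d →ₘ[volume] ℂ) (x - act A⁻¹ s)) (act A t) := by
    refine integral_congr_ae ?_
    filter_upwards [coeFn_D2 A f] with t ht
    rw [ht, act_inv_act]
  rw [e1, e2, integral_comp_act A fun s => (((√(absDet A) : ℝ) : ℂ) * f s) *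
    (ψ : Space d →ₘ[volume] ℂ) (x - act A⁻¹ s), ← integral_smul, ← integral_const_mul]
  congr 1
  funext t
  rw [Complex.real_smul]
  ring

theorem W_D2 (Φ : Set (L1L2 d)) (A : GL (Fin d) ℝ) (N : ℕ) (f : L2 d) :
    W Φ N (D2 A f) = W (D1 A⁻¹ '' Φ) N f := by
  induction N generalizing f with
  | zero => rw [W_zero, W_zero, enorm_D2]
  | succ N ih =>
    rw [W_succ, W_succ, ← (Equiv.Set.image _ Φ (D1_injective A⁻¹)).tsum_eq]
    refine tsum_congr fun ψ => ?_
    rw [conv_D2, modulus_D2, ih]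
    rfl

/-! ### Dilated filter banks -/

/-- Bounded integrable functions are dense in `L²(ℝ^d)`. -/
theorem exists_bounded_integrable_close (f : L2 d) {ε : ℝ≥0∞} (hε : ε ≠ 0) :
    ∃ g : L2 d, ‖f - g‖ₑ ≤ ε ∧ MemLp g 1 volume ∧ ∃ c : ℝ, ∀ᵐ x, ‖g x‖ ≤ c := by
  obtain ⟨g, hgs, hfg, hgc, hg⟩ :=
    (Lp.memLp f).exists_hasCompactSupport_eLpNorm_sub_le (by norm_num) hε
  refine ⟨hg.toLp g, ?_, ?_, ?_⟩
  · rw [← edist_eq_enorm_sub, Lp.edist_def]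
    refine le_trans (le_of_eq (eLpNorm_congr_ae ?_)) hfg
    filter_upwards [hg.coeFn_toLp] with x hx
    rw [Pi.sub_apply, Pi.sub_apply, hx]
  · exact (memLp_congr_ae hg.coeFn_toLp).2
      (memLp_one_iff_integrable.2 (hgc.integrable_of_hasCompactSupport hgs))
  · obtain ⟨c, hc⟩ := hgs.exists_bound_of_continuous hgc
    exact ⟨c, by filter_upwards [hg.coeFn_toLp] with x hx; rw [hx]; exact hc x⟩

theorem tendsto_absDet (hd : 1 ≤ d) {A : ℕ+ → GL (Fin d) ℝ}
    (hA : Tendsto (fun m => sigmaMin (A m)) atTop atTop) :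
    Tendsto (fun m => absDet (A m)) atTop atTop :=
  tendsto_atTop_mono (fun m => sigmaMin_pow_le_absDet (A m))
    ((tendsto_pow_atTop (by omega)).comp hA)

/-- The normalization contributes `|det A|⁻¹` and the change of variables `|det A|^(1/2)`. -/
theorem eLpNorm_D1_inv (A : GL (Fin d) ℝ) (ψ : L1L2 d) :
    eLpNorm (D1 A⁻¹ ψ : Space d →ₘ[volume] ℂ) 2 volume =
      ENNReal.ofReal (√(absDet A))⁻¹ * eLpNorm (ψ : Space d →ₘ[volume] ℂ) 2 volume := by
  have h := absDet_pos A
  rw [eLpNorm_congr_ae (coeFn_D1 A⁻¹ ψ)]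
  change eLpNorm (((absDet A⁻¹ : ℝ) : ℂ) •
    fun x => (ψ : Space d →ₘ[volume] ℂ) (act A⁻¹ x)) 2 volume = _
  rw [eLpNorm_const_smul, eLpNorm_comp_act A⁻¹ ψ.memLp_two.1, ← mul_assoc,
    ← ofReal_norm, Complex.norm_real, Real.norm_of_nonneg (absDet_pos _).le,
    ← ENNReal.ofReal_mul (absDet_pos _).le, absDet_inv]
  congr 2
  rw [Real.sqrt_inv, inv_inv]
  field_simp
  exact Real.sq_sqrt h.le

/-- This is the Parseval identity evaluated at `D2 A f`. -/
theorem IsFilterBank.dilate {χ : L1L2 d} {Ψ : Set (L1L2 d)} (hΨ : IsFilterBank χ Ψ)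
    (A : GL (Fin d) ℝ) (f : L2 d) :
    ‖conv f (D1 A⁻¹ χ)‖ₑ ^ 2 + W (D1 A⁻¹ '' Ψ) 1 f = ‖f‖ₑ ^ 2 := by
  have h := hΨ.parseval (D2 A f)
  rwa [conv_D2, enorm_D2, enorm_D2, tsum_enorm_conv_eq_W, W_D2] at h

theorem IsFilterBank.isBesselFamily {χ : L1L2 d} {Ψ : Set (L1L2 d)} (hΨ : IsFilterBank χ Ψ) :
    IsBesselFamily Ψ := fun f => hΨ.parseval f ▸ le_add_self

/-- For integrable signals, Young's inequality and the decay of the dilated `χ` in `L²` suffice;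
density gives the rest, because convolution with each dilated `χ` is a contraction of `L²` by
`IsFilterBank.dilate`. -/
theorem IsFilterBank.tendsto_conv_D1 {χ : L1L2 d} {Ψ : Set (L1L2 d)} (hΨ : IsFilterBank χ Ψ)
    {A : ℕ+ → GL (Fin d) ℝ} (hA : Tendsto (fun m => absDet (A m)) atTop atTop) (f : L2 d) :
    Tendsto (fun m => ‖conv f (D1 (A m)⁻¹ χ)‖ₑ) atTop (𝓝 0) := by
  rw [ENNReal.tendsto_nhds_zero]
  intro ε hε
  have hε2 : 0 < ε / 2 := ENNReal.half_pos hε.ne'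
  obtain ⟨g, hfg, hg, -⟩ := exists_bounded_integrable_close f hε2.ne'
  have hlim : Tendsto (fun m => eLpNorm g 1 volume *
      (ENNReal.ofReal (√(absDet (A m)))⁻¹ * eLpNorm (χ : Space d →ₘ[volume] ℂ) 2 volume))
      atTop (𝓝 0) := by
    have h1 : Tendsto (fun m => ENNReal.ofReal (√(absDet (A m)))⁻¹) atTop (𝓝 0) := by
      rw [← ENNReal.ofReal_zero]
      exact ENNReal.tendsto_ofReal (tendsto_inv_atTop_zero.comp (Real.tendsto_sqrt_atTop.comp hA))
    have h2 := ENNReal.Tendsto.const_mul (a := eLpNorm g 1 volume)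
      (ENNReal.Tendsto.mul_const h1 (Or.inr χ.memLp_two.2.ne)) (Or.inr hg.2.ne)
    simpa using h2
  filter_upwards [(ENNReal.tendsto_nhds_zero.1 hlim) _ hε2] with m hm
  have h1 : ‖conv (f - g) (D1 (A m)⁻¹ χ)‖ₑ ≤ ε / 2 := by
    refine le_trans ?_ hfg
    rw [← ENNReal.pow_le_pow_left_iff two_ne_zero, ← hΨ.dilate (A m) (f - g)]
    exact le_self_add
  have h2 : ‖conv g (D1 (A m)⁻¹ χ)‖ₑ ≤ ε / 2 :=
    ((enorm_conv_le g hg _).trans (le_of_eq (by rw [eLpNorm_D1_inv]))).trans hm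
  calc ‖conv f (D1 (A m)⁻¹ χ)‖ₑ
      = ‖conv (f - g) (D1 (A m)⁻¹ χ) + conv g (D1 (A m)⁻¹ χ)‖ₑ := by rw [conv_sub]; congr 1; abel
    _ ≤ ε / 2 + ε / 2 := (enorm_add_le _ _).trans (add_le_add h1 h2)
    _ = ε := ENNReal.add_halves ε

theorem tendsto_W_iUnion {Φ : ℕ+ → Set (L1L2 d)} (hΦ : Monotone Φ) (N : ℕ) (f : L2 d) :
    Tendsto (fun m => W (Φ m) N f) atTop (𝓝 (W (⋃ m, Φ m) N f)) := by
  rw [W_iUnion hΦ]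
  exact tendsto_atTop_iSup fun m n h => W_mono (hΦ h) N f

theorem IsFilterBank.isSemiDiscreteParsevalFrame {χ : L1L2 d} {Ψ : Set (L1L2 d)}
    (hΨ : IsFilterBank χ Ψ) {A : ℕ+ → GL (Fin d) ℝ}
    (hA : Tendsto (fun m => absDet (A m)) atTop atTop)
    (hmono : Monotone fun m => D1 (A m)⁻¹ '' Ψ) :
    IsSemiDiscreteParsevalFrame (⋃ m : ℕ+, D1 (A m)⁻¹ '' Ψ) := by
  refine ⟨Set.countable_iUnion fun m =>
    (hΨ.countable.mono (Set.subset_insert _ _)).image _, fun f => ?_⟩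
  rw [tsum_enorm_conv_eq_W]
  have h1 := ((ENNReal.continuous_pow 2).tendsto 0).comp (hΨ.tendsto_conv_D1 hA f)
  have h2 := h1.add (tendsto_W_iUnion hmono 1 f)
  simp only [Function.comp_def, hΨ.dilate] at h2
  simpa using (tendsto_nhds_unique h2 tendsto_const_nhds)

theorem IsFilterBank.tendsto_W_D2 {χ : L1L2 d} {Ψ : Set (L1L2 d)}
    (hΨ : IsFilterBank χ Ψ) {A : ℕ+ → GL (Fin d) ℝ}
    (hA : Tendsto (fun m => absDet (A m)) atTop atTop)
    (hmono : Monotone fun m => D1 (A m)⁻¹ '' Ψ) (N : ℕ) (f : L2 d) :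
    Tendsto (fun m => W Ψ N (D2 (A m) f)) atTop (𝓝 (‖f‖ₑ ^ 2)) := by
  simp only [W_D2]
  rw [← W_eq_enorm_sq (hΨ.isSemiDiscreteParsevalFrame hA hmono) N f]
  exact tendsto_W_iUnion hmono N f

/-! ### Perturbations of dilated signals -/

theorem enorm_sq_eq_lintegral (f : L2 d) : ‖f‖ₑ ^ 2 = ∫⁻ x, ‖f x‖ₑ ^ 2 := by
  rw [Lp.enorm_def, eLpNorm_eq_lintegral_rpow_enorm_toReal (by norm_num) (by norm_num),
    ← ENNReal.rpow_two, ← ENNReal.rpow_mul]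
  simp

theorem enorm_sq_le_liminf {f : ℕ+ → L2 d} {g : L2 d}
    (h : ∀ᵐ x, Tendsto (fun m => f m x) atTop (𝓝 (g x))) :
    ‖g‖ₑ ^ 2 ≤ liminf (fun m => ‖f m‖ₑ ^ 2) atTop := by
  simp only [enorm_sq_eq_lintegral]
  refine le_trans (le_of_eq (lintegral_congr_ae ?_)) (lintegral_liminf_le'
    fun m => (Lp.aestronglyMeasurable (f m)).enorm.pow_const 2)
  filter_upwards [h] with x hx
  exact (((ENNReal.continuous_pow 2).tendsto _).comp
    ((continuous_enorm.tendsto _).comp hx)).liminf_eq.symm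

/-- Fatou is used twice: in `x` for each path, then over paths with counting measure. Hence the
constant `K` may depend on the path. -/
theorem W_le_liminf (Φ : Set (L1L2 d)) (N : ℕ) {f : ℕ+ → L2 d} {g : L2 d} {c : ℕ+ → ℝ}
    (hc : Tendsto c atTop (𝓝 0)) (h : ∀ m, ∀ᵐ x, ‖f m x - g x‖ ≤ c m) :
    W Φ N g ≤ liminf (fun m => W Φ N (f m)) atTop := by
  let _ : MeasurableSpace (Fin N → Φ) := ⊤
  have : MeasurableSingletonClass (Fin N → Φ) := ⟨fun _ => trivial⟩
  have hf := lintegral_liminf_le (μ := Measure.count) (u := atTop)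
    (f := fun m (p : Fin N → Φ) => ‖U N (fun i => (p i : L1L2 d)) (f m)‖ₑ ^ 2)
    fun m => measurable_from_top
  simp only [lintegral_count] at hf
  refine le_trans (ENNReal.tsum_le_tsum fun p => enorm_sq_le_liminf ?_) hf
  obtain ⟨K, hK⟩ := exists_ae_norm_U_sub_le N fun i => (p i : L1L2 d)
  filter_upwards [ae_all_iff.2 fun m => hK (f m) g (c m) (h m)] with x hx
  rw [tendsto_iff_norm_sub_tendsto_zero]
  refine squeeze_zero (fun _ => norm_nonneg _) hx ?_
  simpa using hc.mul_const K

/-- Adding a fixed signal to a strongly dilated one asymptotically does not lower the energy. -/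
theorem IsFilterBank.eventually_lt_sqrt_W_add_D2 {χ : L1L2 d} {Ψ : Set (L1L2 d)}
    (hΨ : IsFilterBank χ Ψ) {A : ℕ+ → GL (Fin d) ℝ}
    (hA : Tendsto (fun m => absDet (A m)) atTop atTop)
    (hmono : Monotone fun m => D1 (A m)⁻¹ '' Ψ) (N : ℕ) (f g : L2 d) {c : ℝ≥0∞}
    (hc : c < ‖g‖ₑ) :
    ∀ᶠ m in atTop, c < W Ψ N (f + D2 (A m) g) ^ (1 / 2 : ℝ) := by
  obtain ⟨b, hcb, hb⟩ := exists_between hc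
  -- Replacing `f` by a bounded `f'` costs at most `b - c` in `√W`.
  obtain ⟨f', hff', -, M, hM⟩ := exists_bounded_integrable_close f (tsub_pos_of_lt hcb).ne'
  have hsup : b ^ 2 < ⨆ m, W (D1 (A m)⁻¹ '' Ψ) N g := by
    rw [← W_iUnion hmono, W_eq_enorm_sq (hΨ.isSemiDiscreteParsevalFrame hA hmono)]
    exact (ENNReal.pow_lt_pow_left_iff two_ne_zero).2 hb
  -- Freezing one filter set `Ψ_{m₀}` leaves only the signal varying with `m`, as `W_le_liminf`
  -- requires; monotonicity returns to `Ψ_m` afterwards.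
  obtain ⟨m₀, hm₀⟩ := lt_iSup_iff.1 hsup
  have hdil (m : ℕ+) : ∀ᵐ x, ‖(D2 (A m)⁻¹ f' + g : L2 d) x - g x‖ ≤ (√(absDet (A m)))⁻¹ * M := by
    filter_upwards [Lp.coeFn_add (D2 (A m)⁻¹ f') g, coeFn_D2 (A m)⁻¹ f',
      (quasiMeasurePreserving_act (A m)⁻¹).ae hM] with x h1 h2 h3
    rw [h1, Pi.add_apply, add_sub_cancel_right, h2, norm_mul, Complex.norm_real,
      Real.norm_of_nonneg (Real.sqrt_nonneg _), absDet_inv, Real.sqrt_inv]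
    gcongr
  have hlim : Tendsto (fun m => (√(absDet (A m)))⁻¹ * M) atTop (𝓝 0) := by
    simpa using (tendsto_inv_atTop_zero.comp (Real.tendsto_sqrt_atTop.comp hA)).mul_const M
  filter_upwards [eventually_lt_of_lt_liminf
    (hm₀.trans_le (W_le_liminf (D1 (A m₀)⁻¹ '' Ψ) N hlim hdil)), eventually_ge_atTop m₀]
    with m hm hmm
  have h1 : b ^ 2 < W Ψ N (f' + D2 (A m) g) := by
    refine hm.trans_le ((W_mono (hmono hmm) N _).trans (le_of_eq ?_))
    rw [← W_D2, D2_add, D2_D2_inv]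
  have h2 : b < W Ψ N (f' + D2 (A m) g) ^ (1 / 2 : ℝ) := by
    refine lt_of_eq_of_lt ?_ (ENNReal.rpow_lt_rpow h1 (by norm_num))
    rw [← ENNReal.rpow_two, ← ENNReal.rpow_mul]
    norm_num
  have h3 := sqrt_W_le hΨ.isBesselFamily N (f' + D2 (A m) g) (f + D2 (A m) g)
  rw [add_sub_add_right_eq_sub, ← edist_eq_enorm_sub, edist_comm, edist_eq_enorm_sub] at h3
  by_contra! h4
  have h5 := h2.trans_le (h3.trans (add_le_add h4 hff'))
  rw [add_tsub_cancel_of_le hcb.le] at h5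
  exact h5.false

/-! ### Signals with slowly decaying energy -/

theorem norm_D2 (A : GL (Fin d) ℝ) (f : L2 d) : ‖D2 A f‖ = ‖f‖ := by
  rw [← toReal_enorm, enorm_D2, toReal_enorm]

theorem IsNullSeq.finite_lt {E : ℕ+ → ℝ} (hE : IsNullSeq E) {x : ℝ} (hx : 0 < x) :
    {N | x < E N}.Finite := by
  obtain ⟨N₀, h⟩ := eventually_atTop.1 (hE.tendsto.eventually (gt_mem_nhds hx))
  refine (Set.finite_Iio N₀).subset fun N hN => ?_
  by_contra hle
  exact (h N (not_lt.1 hle)).not_gt hN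

theorem IsFilterBank.exists_slow_decay {χ : L1L2 d} {Ψ : Set (L1L2 d)}
    (hΨ : IsFilterBank χ Ψ) {A : ℕ+ → GL (Fin d) ℝ}
    (hA : Tendsto (fun m => absDet (A m)) atTop atTop)
    (hmono : Monotone fun m => D1 (A m)⁻¹ '' Ψ) (g : L2 d) {E : ℕ+ → ℝ} (hE : IsNullSeq E) :
    ∃ f : L2 d, ‖f - g‖ ≤ 3 * (√(E 1) * ‖g‖) ∧
      ∀ N : ℕ+, ENNReal.ofReal (‖g‖ ^ 2 / 8 * E N) ≤ W Ψ N f := by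
  rcases eq_or_ne g 0 with rfl | hg
  · exact ⟨0, by simp, by simp⟩
  have hE1 : 0 < E 1 := hE.pos 1
  have hg0 : 0 < ‖g‖ := norm_pos_iff.2 hg
  set r : ℝ := √(E 1) * ‖g‖ with hr
  have hr0 : 0 < r := by positivity
  -- The humps have norm `2r/3^j`, with sum `3r`. Those after index `j` sum to `r/3^j`, so a level
  -- of `3r/(2·3^j)` reached at step `j` leaves at least `r/(2·3^j)`.
  set a : ℕ → ℝ := fun j => 2 * √(E 1) * (1 / 3) ^ j with ha
  have ha0 (j : ℕ) : 0 < a j := by positivity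
  have hnorm (j : ℕ) : ‖(a j : ℂ) • g‖ = 2 * r * (1 / 3) ^ j := by
    rw [norm_smul, Complex.norm_real, Real.norm_of_nonneg (ha0 j).le, ha, hr]
    ring
  have hstep (j : ℕ) (h : L2 d) : ∃ m, ∀ N : ℕ+, (1 / 9) ^ (j + 1) * E 1 < E N →
      ENNReal.ofReal (3 / 2 * r * (1 / 3) ^ j) <
        W Ψ N (h + D2 (A m) ((a j : ℂ) • g)) ^ (1 / 2 : ℝ) := by
    have hlt : ENNReal.ofReal (3 / 2 * r * (1 / 3) ^ j) < ‖(a j : ℂ) • g‖ₑ := by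
      rw [← ofReal_norm, hnorm, ENNReal.ofReal_lt_ofReal_iff (by positivity)]
      gcongr
      norm_num
    exact ((eventually_all_finite (hE.finite_lt (x := (1 / 9) ^ (j + 1) * E 1)
      (by positivity))).2 fun N _ =>
        hΨ.eventually_lt_sqrt_W_add_D2 hA hmono N h ((a j : ℂ) • g) hlt).exists
  choose m hm using hstep
  let h : ℕ → L2 d := fun n => Nat.rec g (fun j h => h + D2 (A (m j h)) ((a j : ℂ) • g)) n
  have hsucc (j : ℕ) : h (j + 1) = h j + D2 (A (m j (h j))) ((a j : ℂ) • g) := rfl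
  have hdist (j : ℕ) : dist (h j) (h (j + 1)) ≤ 2 * r * (1 / 3) ^ j := by
    rw [dist_comm, dist_eq_norm, hsucc, add_sub_cancel_left, norm_D2, hnorm]
  obtain ⟨f, hf⟩ := cauchySeq_tendsto_of_complete
    (cauchySeq_of_le_geometric (1 / 3) (2 * r) (by norm_num) hdist)
  have htail := dist_le_of_le_geometric_of_tendsto (1 / 3) (2 * r) (by norm_num) hdist hf
  refine ⟨f, ?_, fun N => ?_⟩
  · have := htail 0
    rw [dist_comm, dist_eq_norm] at this
    exact this.trans (le_of_eq (by ring))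
  -- The scale of `N`: `9^(-(j+1)) E_1 < E_N ≤ 9^(-j) E_1`. The left bound says that hump `j` serves
  -- `N`; the right bound compares the surviving energy with `E_N`.
  · obtain ⟨j, hj1, hj2⟩ := exists_nat_pow_near_of_lt_one (y := (1 / 9 : ℝ))
      (div_pos (hE.pos N) hE1) ((div_le_one hE1).2 (hE.antitone (one_le)))
      (by norm_num) (by norm_num)
    rw [lt_div_iff₀ hE1] at hj1
    rw [div_le_iff₀ hE1] at hj2
    have h1 := hm j (h j) N hj1
    rw [← hsucc] at h1
    have h2 := sqrt_W_le hΨ.isBesselFamily N (h (j + 1)) f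
    have h3 : ‖h (j + 1) - f‖ₑ ≤ ENNReal.ofReal (r * (1 / 3) ^ j) := by
      rw [← ofReal_norm, ← dist_eq_norm]
      refine ENNReal.ofReal_le_ofReal ((htail (j + 1)).trans (le_of_eq ?_))
      ring
    have h4 : ENNReal.ofReal (1 / 2 * r * (1 / 3) ^ j) ≤ W Ψ N f ^ (1 / 2 : ℝ) := by
      have h5 := (h1.le.trans h2).trans (add_le_add le_rfl h3)
      rw [show 3 / 2 * r * (1 / 3) ^ j = 1 / 2 * r * (1 / 3) ^ j + r * (1 / 3) ^ j by ring,
        ENNReal.ofReal_add (by positivity) (by positivity)] at h5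
      exact (ENNReal.add_le_add_iff_right ENNReal.ofReal_ne_top).1 h5
    have h6 := ENNReal.rpow_le_rpow h4 (z := 2) (by norm_num)
    rw [← ENNReal.rpow_mul, ENNReal.rpow_two, ← ENNReal.ofReal_pow (by positivity)] at h6
    norm_num only [ENNReal.rpow_one] at h6
    refine le_trans (ENNReal.ofReal_le_ofReal ?_) h6
    have h7 : (1 / 2 * r * (1 / 3) ^ j) ^ 2 = ‖g‖ ^ 2 / 4 * ((1 / 9) ^ j * E 1) := by
      have h8 : ((1 / 3 : ℝ) ^ j) ^ 2 = (1 / 9) ^ j := by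
        rw [← pow_mul, mul_comm, pow_mul]; norm_num
      rw [mul_pow, h8, hr, mul_pow, mul_pow, Real.sq_sqrt hE1.le]
      ring
    have h9 : ‖g‖ ^ 2 / 8 * E N ≤ (1 / 2 * r * (1 / 3) ^ j) ^ 2 := by
      rw [h7]
      have := (hE.pos N).le
      gcongr
      norm_num
    exact h9

theorem isClosed_W_le {Φ : Set (L1L2 d)} (hΦ : IsBesselFamily Φ) (N : ℕ) (c : ℝ≥0∞) :
    IsClosed {f : L2 d | W Φ N f ≤ c} := by
  refine IsSeqClosed.isClosed fun f g hf hfg => ?_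
  have h1 : Tendsto (fun n => c ^ (1 / 2 : ℝ) + ‖g - f n‖ₑ) atTop (𝓝 (c ^ (1 / 2 : ℝ) + 0)) := by
    refine tendsto_const_nhds.add ?_
    simpa only [edist_comm, edist_eq_enorm_sub] using tendsto_iff_edist_tendsto_0.1 hfg
  have h2 : W Φ N g ^ (1 / 2 : ℝ) ≤ c ^ (1 / 2 : ℝ) := by
    rw [← add_zero (c ^ (1 / 2 : ℝ))]
    refine ge_of_tendsto' h1 fun n => (sqrt_W_le hΦ N g (f n)).trans ?_
    exact add_le_add (ENNReal.rpow_le_rpow (hf n) (by norm_num)) le_rfl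
  exact (ENNReal.rpow_le_rpow_iff (by norm_num)).1 h2

theorem exists_norm_eq_one (d : ℕ) : ∃ f : L2 d, ‖f‖ = 1 := by
  have hs : MeasurableSet (Metric.ball (0 : Space d) 1) := Metric.isOpen_ball.measurableSet
  have hfin : volume (Metric.ball (0 : Space d) 1) ≠ ⊤ := measure_ball_lt_top.ne
  have hpos : 0 < volume.real (Metric.ball (0 : Space d) 1) :=
    ENNReal.toReal_pos (Metric.measure_ball_pos volume _ one_pos).ne' hfin
  have hne : indicatorConstLp 2 hs hfin (1 : ℂ) ≠ 0 := by
    rw [← norm_pos_iff, norm_indicatorConstLp (by norm_num) (by norm_num)]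
    exact mul_pos (by simp) (Real.rpow_pos_of_pos hpos _)
  exact ⟨((‖indicatorConstLp 2 hs hfin (1 : ℂ)‖⁻¹ : ℝ) : ℂ) • indicatorConstLp 2 hs hfin (1 : ℂ), by
    rw [norm_smul, Complex.norm_real, norm_inv, norm_norm,
      inv_mul_cancel₀ (norm_ne_zero_iff.2 hne)]⟩

/-- Slow decay is applied to a multiple of `√E_N`, which eventually exceeds every `C * E_N`. The
centre `g` must be nonzero, since the lower bound scales with `‖g‖²`. -/
theorem IsFilterBank.exists_dist_lt_notMem_fastSet {χ : L1L2 d} {Ψ : Set (L1L2 d)}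
    (hΨ : IsFilterBank χ Ψ) {A : ℕ+ → GL (Fin d) ℝ}
    (hA : Tendsto (fun m => absDet (A m)) atTop atTop)
    (hmono : Monotone fun m => D1 (A m)⁻¹ '' Ψ) {E : ℕ+ → ℝ} (hE : IsNullSeq E)
    (f : L2 d) {ε : ℝ} (hε : 0 < ε) : ∃ h ∉ fastSet Ψ E, dist h f < ε := by
  have : Nontrivial (L2 d) := by
    obtain ⟨u, hu⟩ := exists_norm_eq_one d
    exact ⟨u, 0, by rintro rfl; simp at hu⟩
  have : (𝓝[≠] (0 : L2 d)).NeBot := Module.punctured_nhds_neBot ℂ (L2 d) 0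
  obtain ⟨g, hg, hgf⟩ := (dense_compl_singleton (0 : L2 d)).exists_dist_lt f (half_pos hε)
  have hg0 : 0 < ‖g‖ := norm_pos_iff.2 hg
  have hE1 := hE.pos 1
  set t : ℝ := ε / (8 * ‖g‖) with ht
  have ht0 : 0 < t := by positivity
  -- Chosen so that the first term of the new sequence is `t²`; then `h` lies within `3t‖g‖ = 3ε/8`
  -- of `g`.
  set s : ℝ := t ^ 2 / √(E 1) with hs
  have hs0 : 0 < s := by positivity
  have hE' : IsNullSeq fun N => s * √(E N) := by
    refine ⟨fun N => ?_, fun N N' h => ?_, ?_⟩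
    · have := hE.pos N
      positivity
    · exact mul_le_mul_of_nonneg_left (Real.sqrt_le_sqrt (hE.antitone h)) hs0.le
    · simpa using ((Real.continuous_sqrt.tendsto 0).comp hE.tendsto).const_mul s
  obtain ⟨h, hhg, hW⟩ := hΨ.exists_slow_decay hA hmono g hE'
  refine ⟨h, ?_, ?_⟩
  · rintro ⟨C, hC, N₀, hN₀⟩
    have hlim : Tendsto (fun N => C * √(E N)) atTop (𝓝 0) := by
      simpa using ((Real.continuous_sqrt.tendsto 0).comp hE.tendsto).const_mul C
    obtain ⟨N, hN, hNN₀⟩ := ((hlim.eventually (gt_mem_nhds (show 0 < ‖g‖ ^ 2 / 8 * s by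
      positivity))).and (eventually_ge_atTop N₀)).exists
    have hEN := hE.pos N
    have h1 := (hW N).trans (hN₀ N hNN₀)
    rw [ENNReal.ofReal_le_ofReal_iff (by positivity)] at h1
    have h2 := mul_lt_mul_of_pos_right hN (Real.sqrt_pos.2 hEN)
    rw [mul_assoc, Real.mul_self_sqrt hEN.le, mul_assoc] at h2
    exact (h1.trans_lt h2).false
  · have h1 : √(s * √(E 1)) = t := by
      rw [hs, div_mul_cancel₀ _ (by positivity), Real.sqrt_sq ht0.le]
    have h2 : dist h g ≤ 3 * ε / 8 := by
      rw [dist_eq_norm]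
      refine hhg.trans (le_of_eq ?_)
      rw [h1, ht]
      field_simp
    have h3 := dist_triangle h g f
    rw [dist_comm g f] at h3
    linarith

/-- The signals whose energies are bounded by `n E_N` for all `N ≥ n`. -/
def fastSetLevel (Ψ : Set (L1L2 d)) (E : ℕ+ → ℝ) (n : ℕ) : Set (L2 d) :=
  {f | ∀ N : ℕ+, n ≤ N → W Ψ N f ≤ ENNReal.ofReal (n * E N)}

theorem fastSet_eq_iUnion (Ψ : Set (L1L2 d)) {E : ℕ+ → ℝ} (hE : IsNullSeq E) :
    fastSet Ψ E = ⋃ n, fastSetLevel Ψ E n := by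
  refine Set.Subset.antisymm ?_ (Set.iUnion_subset fun n => ?_)
  · rintro f ⟨C, hC, N₀, hf⟩
    obtain ⟨n, hn⟩ := exists_nat_ge (max C N₀)
    have h1 : (N₀ : ℕ) ≤ n := by exact_mod_cast (le_max_right _ _).trans hn
    refine Set.mem_iUnion.2 ⟨n, fun N hN => (hf N (PNat.coe_le_coe _ _ |>.1 (h1.trans hN))).trans ?_⟩
    exact ENNReal.ofReal_le_ofReal
      (mul_le_mul_of_nonneg_right ((le_max_left _ _).trans hn) (hE.pos N).le)
  · intro f hf
    -- The shift to `n + 1` covers `n = 0`, where neither constant would be positive.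
    refine ⟨n + 1, by positivity, n.succPNat, fun N hN => (hf N ?_).trans ?_⟩
    · have : n + 1 ≤ (N : ℕ) := hN
      omega
    · exact ENNReal.ofReal_le_ofReal (mul_le_mul_of_nonneg_right (by linarith) (hE.pos N).le)

theorem isClosed_fastSetLevel {Ψ : Set (L1L2 d)} (hΨ : IsBesselFamily Ψ) (E : ℕ+ → ℝ) (n : ℕ) :
    IsClosed (fastSetLevel Ψ E n) := by
  simp only [fastSetLevel, Set.ofPred_forall]
  exact isClosed_iInter fun N => isClosed_iInter fun _ => isClosed_W_le hΨ N _

end Scattering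

theorem mainTheorem3 {d : ℕ} (hd : 1 ≤ d) (χ : L1L2 d) (Ψ : Set (L1L2 d))
    (hΨ : IsFilterBank χ Ψ) (A : ℕ+ → GL (Fin d) ℝ)
    (hA : Tendsto (fun m => sigmaMin (A m)) atTop atTop)
    (hincl : ∀ m : ℕ+, D1 (A m)⁻¹ '' Ψ ⊆ D1 (A (m + 1))⁻¹ '' Ψ) :
    IsSemiDiscreteParsevalFrame (⋃ m : ℕ+, D1 (A m)⁻¹ '' Ψ) ∧
    (∀ (f : L2 d) (k : ℕ+),
      Tendsto (fun m : ℕ+ => W Ψ k (D2 (A m) f)) atTop (𝓝 (‖f‖ₑ ^ 2))) ∧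
    slowDelta Ψ A = 1 ∧
    (∀ g : L2 d, ∃ C > (0 : ℝ), ∀ E : ℕ+ → ℝ, IsNullSeq E →
      ∃ f : L2 d, ‖f‖ ^ 2 ≤ C * (1 + E 1) ∧ ‖f - g‖ ^ 2 ≤ C * E 1 ∧
        ∀ N : ℕ+, ENNReal.ofReal (‖g‖ ^ 2 / 8 * E N) ≤ W Ψ N f) ∧
    (∀ E : ℕ+ → ℝ, IsNullSeq E →
      (∃ M : ℕ → Set (L2 d), (∀ n, IsNowhereDense (M n)) ∧ fastSet Ψ E = ⋃ n, M n) ∧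
      Dense (fastSet Ψ E)ᶜ) := by
  have hdet := tendsto_absDet hd hA
  have hmono : Monotone fun m => D1 (A m)⁻¹ '' Ψ := by
    intro m n hmn
    induction n using PNat.recOn with
    | one => rw [le_antisymm hmn one_le]
    | succ n ih =>
      rcases hmn.lt_or_eq with h | rfl
      · exact (ih (PNat.lt_add_one_iff.1 h)).trans (hincl n)
      · exact le_rfl
  have hlim := hΨ.tendsto_W_D2 hdet hmono
  refine ⟨hΨ.isSemiDiscreteParsevalFrame hdet hmono, fun f k => hlim k f, ?_, fun g => ?_,
    fun E hE => ?_⟩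
  · have : Nonempty {f : L2 d // ‖f‖ = 1} := nonempty_subtype.2 (exists_norm_eq_one d)
    have h1 (f : {f : L2 d // ‖f‖ = 1}) (k : ℕ+) :
        limsup (fun m : ℕ+ => W Ψ k (D2 (A m) f)) atTop = 1 := by
      rw [(hlim k f).limsup_eq, ← ofReal_norm, f.2]
      simp
    simp only [slowDelta, h1, iInf_const]
  -- `18 = 2 · 3²`, from `‖f‖² ≤ 2‖f - g‖² + 2‖g‖²`; the `+ 1` keeps the constant positive when `g =
  -- 0`.
  · refine ⟨18 * ‖g‖ ^ 2 + 1, by positivity, fun E hE => ?_⟩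
    have hE1 := hE.pos 1
    obtain ⟨f, hf, hW⟩ := hΨ.exists_slow_decay hdet hmono g hE
    have h1 : ‖f - g‖ ^ 2 ≤ 9 * (E 1 * ‖g‖ ^ 2) := by
      refine (pow_le_pow_left₀ (norm_nonneg _) hf 2).trans (le_of_eq ?_)
      rw [mul_pow, mul_pow, Real.sq_sqrt hE1.le]
      norm_num
    have h2 : ‖f‖ ^ 2 ≤ 2 * ‖f - g‖ ^ 2 + 2 * ‖g‖ ^ 2 := by
      have h3 : ‖f‖ ≤ ‖f - g‖ + ‖g‖ := by simpa using norm_add_le (f - g) g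
      nlinarith [norm_nonneg f, sq_nonneg (‖f - g‖ - ‖g‖)]
    have h4 : 0 ≤ E 1 * ‖g‖ ^ 2 := by positivity
    exact ⟨f, by nlinarith [sq_nonneg ‖g‖], by nlinarith, hW⟩
  · have hdense : Dense (fastSet Ψ E)ᶜ := Metric.dense_iff.2 fun f ε hε => by
      obtain ⟨h, hh, hhf⟩ := hΨ.exists_dist_lt_notMem_fastSet hdet hmono hE f hε
      exact ⟨h, hhf, hh⟩
    refine ⟨⟨fastSetLevel Ψ E, fun n => ?_, fastSet_eq_iUnion Ψ hE⟩, hdense⟩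
    -- A closed set is nowhere dense once its complement is dense, and here the complement contains
    -- that of `Y_E`. Baire's theorem is not needed.
    rw [(isClosed_fastSetLevel hΨ.isBesselFamily E n).isNowhereDense_iff,
      interior_eq_empty_iff_dense_compl]
    refine hdense.mono (Set.compl_subset_compl.2 ?_)
    rw [fastSet_eq_iUnion Ψ hE]
    exact Set.subset_iUnion _ n
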